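/- Let $m$ be Lebesgue (product) measure on the Borel subsets of $[0,1]^{\mathbb N}$, i.e. the countable product of the uniform distribution on $[0,1]$, and let $\lambda$ be the completion of $m$; the sets in the completed $\sigma$-algebra are called Lebesgue measurable. For $A\subseteq[0,1]^{\mathbb N}$ and $K\subseteq\mathbb N$ put $$[A]_K:=\{\omega\in[0,1]^{\mathbb N}:\ \text{every }\omega'\in[0,1]^{\mathbb N}\text{ with }\omega'_i=\omega_i\text{ for all }i\in K\text{ lies in }A\}.$$ Define the BKR combinations (the events occur for finite disjoint sets of reasons) by $$A\,\square\,B:=\bigcup_{\substack{J,K\subset\mathbb N\\ \text{finite, disjoint}}}[A]_J\cap[B]_K,\qquad \mathop{\square}_{1\le i\le r}A_i:=\bigcup_{\substack{J_1,\dots,J_r\subset\mathbb N\\ \text{finite, pairwise disjoint}}}\ \bigcap_{i=1}^r[A_i]_{J_i}.$$ **Theorem.** (i) For all Borel sets $A,B\subseteq[0,1]^{\mathbb N}$, the set $A\,\square\,B$ is Lebesgue measurable and $$\lambda(A\,\square\,B)\le m(A)\,m(B).$$ (ii) For every $r$ and all Borel sets $A_1,\dots,A_r\subseteq[0,1]^{\mathbb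 N}$, the set $\mathop{\square}_{1\le i\le r}A_i$ is Lebesgue measurable and $$\lambda\Big(\mathop{\square}_{1\le i\le r}A_i\Big)\le\prod_{i=1}^r m(A_i).$$ -/

import Mathlib

open MeasureTheory

namespace BKR

/-- The thin cylinder `Cyl(K, ω)` in `S^I`: all points that agree with `ω` on the coordinates
in `K`. -/
def Cyl {I S : Type*} (K : Set I) (ω : I → S) : Set (I → S) :=
  {ω' | ∀ i ∈ K, ω' i = ω i}

/-- `[A]_K`, the largest cylinder set contained in `A` and free in the directions outside `K`. -/
def maxCyl {I S : Type*} (A : Set (I → S)) (K : Set I) : Set (I → S) :=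
  {ω | Cyl K ω ⊆ A}

/-- The BKR combination `A □ B`: the events `A` and `B` occur for finite disjoint sets of
reasons, i.e. the union of `[A]_J ∩ [B]_K` over finite disjoint sets `J`, `K` of indices. -/
def bkr {I S : Type*} (A B : Set (I → S)) : Set (I → S) :=
  {ω | ∃ J K : Finset I, Disjoint J K ∧ ω ∈ maxCyl A (J : Set I) ∩ maxCyl B (K : Set I)}

/-- The simultaneous `r`-fold BKR combination: the union of `⋂ i, [A_i]_{J_i}` over families
of finite pairwise disjoint sets `J_1, …, J_r` of indices. -/
def bkrFold {I S : Type*} {r : ℕ} (A : Fin r → Set (I → S)) : Set (I → S) :=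
  {ω | ∃ J : Fin r → Finset I, (∀ i j, i ≠ j → Disjoint (J i) (J j)) ∧
    ω ∈ ⋂ i, maxCyl (A i) (J i : Set I)}

/-- `m`: Lebesgue measure on the Borel sets of `[0,1]^ℕ`, the countable product of the uniform
distribution on `[0,1]`. -/
noncomputable def m : Measure (ℕ → unitInterval) :=
  Measure.infinitePi fun _ : ℕ => (volume : Measure unitInterval)

/-- A subset of `[0,1]^ℕ` is Lebesgue measurable if it belongs to the completion of the Borel
sigma-algebra with respect to `m`. -/
def LebesgueMeasurable (A : Set (ℕ → unitInterval)) : Prop :=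
  NullMeasurableSet A m

/-- `lam`: Lebesgue measure on the Lebesgue measurable subsets of `[0,1]^ℕ`, the completion
of `m`. -/
noncomputable def lam : Measure (NullMeasurableSpace (ℕ → unitInterval) m) :=
  m.completion

end BKR

/-! The core is Reimer's inequality on the discrete cube, `card_le_card_inter_reflection`, proved by
linear algebra. To each `x` in `X` is attached a tensor vector supported in the subcube of `A`
through `x`, whose image under a positive definite tensor power is supported in the reflected
subcube of `B`. A combination `u` vanishing on the intersection of `A` with the reflection of `B`
satisfies `uᵀ G u = 0`, so `u = 0`; since the vectors are independent, restriction to that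
intersection is injective.

For a finite set `N` of coordinates, take two independent copies of the point and let `ε : N → Bool`
choose a copy in each coordinate. For fixed copies Reimer's inequality compares the numbers of good
`ε`; integration turns this into `m U ≤ m A * m B`. Letting `N` grow removes the finiteness
restriction.

Measurability holds because `[A]_K` is coanalytic, and analytic sets are universally measurable. -/

namespace BKR

/-! ### Reimer's inequality on the discrete cube -/

/-- A factor of the tensor product `⊗ i, bodyCoord (s i) (x i)` on the discrete cube. It is the
indicator of `{x}` if the coordinate is fixed (`s = true`). -/
def bodyCoord (s x b : Bool) : ℤ := if b = x then 1 else if s then 0 else 2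

/-- A `3 × 2` integer matrix `H` such that `Hᵀ H` is positive definite and maps
`bodyCoord false x` to a multiple of the indicator of `{!x}`. -/
def rootCoord : Option Bool → Bool → ℤ
  | none, b => if b then 1 else -1
  | some c, b => if b = c then 1 else 0

/-- The entries of `Hᵀ H`. -/
def gramCoord (b c : Bool) : ℤ := ∑ t, rootCoord t b * rootCoord t c

lemma sum_bodyCoord_mul_gramCoord (x : Bool) :
    ∑ c, bodyCoord false x c * gramCoord c x = 0 := by
  revert x; decide

section Cube

variable {ι : Type*} [Fintype ι]

/-- The tensor product of the vectors `bodyCoord (s i) (x i)`. -/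
def bodyVec (s x z : ι → Bool) : ℤ := ∏ i, bodyCoord (s i) (x i) (z i)

/-- The tensor power of `gramCoord`. -/
def gram (z w : ι → Bool) : ℤ := ∏ i, gramCoord (z i) (w i)

lemma bodyVec_eq_zero {s x z : ι → Bool} {i : ι} (hs : s i = true) (hz : z i ≠ x i) :
    bodyVec s x z = 0 :=
  Finset.prod_eq_zero (Finset.mem_univ i) (by simp [bodyCoord, hs, hz])

variable [DecidableEq ι]

lemma sum_bodyVec_mul_gram_eq_zero {s x w : ι → Bool} {i : ι} (hs : s i = false)
    (hw : w i = x i) : ∑ z, bodyVec s x z * gram z w = 0 := by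
  have h : ∑ z, bodyVec s x z * gram z w =
      ∏ i, ∑ c, bodyCoord (s i) (x i) c * gramCoord c (w i) := by
    simp only [bodyVec, gram, ← Finset.prod_mul_distrib]
    rw [Finset.prod_univ_sum, Fintype.piFinset_univ]
  rw [h]
  refine Finset.prod_eq_zero (Finset.mem_univ i) ?_
  rw [hs, hw, sum_bodyCoord_mul_gramCoord]

lemma gram_eq_sum (z w : ι → Bool) :
    gram z w = ∑ t : ι → Option Bool,
      (∏ i, rootCoord (t i) (z i)) * ∏ i, rootCoord (t i) (w i) := by
  simp only [gram, gramCoord, ← Finset.prod_mul_distrib]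
  rw [Finset.prod_univ_sum, Fintype.piFinset_univ]

/-- The form is a sum of squares indexed by `t`; the square at `t i = some (w i)` is that of `u w`
itself. -/
lemma eq_zero_of_gram_eq_zero {u : (ι → Bool) → ℤ}
    (h : ∑ w, (∑ z, u z * gram z w) * u w = 0) : u = 0 := by
  have key : ∑ w, (∑ z, u z * gram z w) * u w =
      ∑ t : ι → Option Bool, (∑ z, u z * ∏ i, rootCoord (t i) (z i)) ^ 2 := by
    simp only [gram_eq_sum, sq, Finset.mul_sum, Finset.sum_mul]
    rw [Finset.sum_comm]
    simp_rw [Finset.sum_comm (s := (Finset.univ : Finset (ι → Bool)))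
      (t := (Finset.univ : Finset (ι → Option Bool)))]
    refine Finset.sum_congr rfl fun t _ => Finset.sum_congr rfl fun z _ =>
      Finset.sum_congr rfl fun w _ => by ring
  rw [key, Finset.sum_eq_zero_iff_of_nonneg fun _ _ => sq_nonneg _] at h
  funext w
  have hw := h (fun i => some (w i)) (Finset.mem_univ _)
  rw [sq_eq_zero_iff, Finset.sum_eq_single w] at hw
  · simpa [rootCoord] using hw
  · intro z _ hz
    obtain ⟨i, hi⟩ := Function.ne_iff.1 hz
    rw [Finset.prod_eq_zero (Finset.mem_univ i) (by simp [rootCoord, hi]), mul_zero]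
  · simp

/-- The vectors `bodyVec (s x) x` are linearly independent, whatever the sets `s x`. -/
lemma eq_zero_of_sum_bodyVec_eq_zero (s : (ι → Bool) → ι → Bool) {c : (ι → Bool) → ℤ}
    (h : ∀ z, ∑ x, c x * bodyVec (s x) x z = 0) : c = 0 := by
  let M : Matrix (ι → Bool) (ι → Bool) ℤ := Matrix.of fun x z => bodyVec (s x) x z
  -- Both shapes of `bodyCoord` reduce mod 2 to the indicator of `x`, so the determinant is odd.
  have hM : M.map (Int.castRingHom (ZMod 2)) = 1 := by
    ext x z
    have h2 : ∀ s x b : Bool, ((bodyCoord s x b : ℤ) : ZMod 2) = if x = b then 1 else 0 := by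
      decide
    simp only [M, Matrix.map_apply, Matrix.of_apply, bodyVec, map_prod, eq_intCast, h2,
      Matrix.one_apply, Finset.prod_ite_zero, Finset.prod_const_one, funext_iff,
      Finset.mem_univ, true_imp_iff]
  have hdet : M.det ≠ 0 := by
    intro h0
    have h1 := (Int.castRingHom (ZMod 2)).map_det M
    rw [h0, map_zero, RingHom.mapMatrix_apply, hM, Matrix.det_one] at h1
    exact zero_ne_one h1
  refine Matrix.eq_zero_of_vecMul_eq_zero hdet ?_
  funext z
  simpa [Matrix.vecMul, dotProduct, M] using h z

/-- **Reimer's theorem** on the discrete cube: if through each point `x` of `X` there pass a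
subcube of `A` and a subcube of `B` with complementary directions, then `X` has at most as many
points as the intersection of `A` with the reflection of `B`. -/
theorem card_le_card_inter_reflection (s : (ι → Bool) → ι → Bool) (A B X : Finset (ι → Bool))
    (hA : ∀ x ∈ X, ∀ z, (∀ i, s x i = true → z i = x i) → z ∈ A)
    (hB : ∀ x ∈ X, ∀ z, (∀ i, s x i = false → z i = x i) → z ∈ B) :
    X.card ≤ (A.filter fun z => (fun i => !z i) ∈ B).card := by
  set C := A.filter fun z => (fun i => !z i) ∈ B with hC
  let M : Matrix C X ℤ := Matrix.of fun z x => bodyVec (s x) x z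
  have hinj : Function.Injective M.mulVecLin := by
    rw [← LinearMap.ker_eq_bot, LinearMap.ker_eq_bot']
    intro c hc
    let c' : (ι → Bool) → ℤ := fun x => if h : x ∈ X then c ⟨x, h⟩ else 0
    let u : (ι → Bool) → ℤ := fun z => ∑ x, c' x * bodyVec (s x) x z
    have hc' : ∀ x ∉ X, c' x = 0 := fun x hx => dif_neg hx
    have huC : ∀ z ∈ C, u z = 0 := by
      intro z hz
      have := congrFun hc ⟨z, hz⟩
      simp only [Matrix.mulVecLin_apply, Matrix.mulVec, dotProduct, M, Matrix.of_apply,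
        Pi.zero_apply] at this
      rw [← this]
      simp only [u]
      rw [← Finset.sum_subset (Finset.subset_univ X)
        fun x _ hx => by rw [hc' x hx, zero_mul], ← Finset.sum_coe_sort]
      exact Finset.sum_congr rfl fun x _ => by simp [c', mul_comm]
    have huA : ∀ z ∉ A, u z = 0 := by
      intro z hz
      refine Finset.sum_eq_zero fun x _ => ?_
      by_cases hx : x ∈ X
      · have : ¬ ∀ i, s x i = true → z i = x i := fun h => hz (hA x hx z h)
        push Not at this
        obtain ⟨i, hi, hne⟩ := this
        rw [bodyVec_eq_zero hi hne, mul_zero]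
      · rw [hc' x hx, zero_mul]
    have hgB : ∀ w, (fun i => !w i) ∉ B → ∑ z, u z * gram z w = 0 := by
      intro w hw
      simp only [u, Finset.sum_mul]
      rw [Finset.sum_comm]
      refine Finset.sum_eq_zero fun x _ => ?_
      simp only [mul_assoc, ← Finset.mul_sum]
      by_cases hx : x ∈ X
      · have : ¬ ∀ i, s x i = false → (!w i) = x i := fun h => hw (hB x hx _ h)
        push Not at this
        obtain ⟨i, hi, hne⟩ := this
        rw [sum_bodyVec_mul_gram_eq_zero hi (by simpa using hne), mul_zero]
      · rw [hc' x hx, zero_mul]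
    -- Every term of `uᵀ G u` dies: `u` vanishes off `A` and on `C`, and `G u` vanishes off the
    -- reflection of `B`.
    have hu : u = 0 := by
      refine eq_zero_of_gram_eq_zero (Finset.sum_eq_zero fun w _ => ?_)
      by_cases hwA : w ∈ A
      · by_cases hwB : (fun i => !w i) ∈ B
        · rw [huC w (Finset.mem_filter.2 ⟨hwA, hwB⟩), mul_zero]
        · rw [hgB w hwB, zero_mul]
      · rw [huA w hwA, mul_zero]
    have h0 := eq_zero_of_sum_bodyVec_eq_zero s (c := c') fun z => congrFun hu z
    funext x
    simpa [c'] using congrFun h0 x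
  simpa using LinearMap.finrank_le_finrank_of_injective hinj

end Cube
-- Universal measurability of analytic sets (Choquet capacitability)
section Analytic

open Set Topology Filter

/-- For an outer regular measure, an analytic set is approximated from inside by compact sets. -/
lemma exists_isCompact_le_measure_of_lt {X : Type*} [TopologicalSpace X] [MeasurableSpace X]
    {μ : Measure X} [μ.OuterRegular] {f : (ℕ → ℕ) → X} (hf : Continuous f) {c : ENNReal}
    (hc : c < μ (range f)) : ∃ K ⊆ range f, IsCompact K ∧ c ≤ μ K := by
  have step : ∀ (k : ℕ) (T : Set (ℕ → ℕ)), ∃ n : ℕ,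
      c < μ (f '' T) → c < μ (f '' (T ∩ {x | x k ≤ n})) := by
    intro k T
    by_cases hT : c < μ (f '' T)
    · have hU : f '' T = ⋃ n : ℕ, f '' (T ∩ {x | x k ≤ n}) := by
        rw [← image_iUnion, ← inter_iUnion]
        congr 1
        refine (inter_eq_left.2 fun x _ => mem_iUnion.2 ⟨x k, le_refl (x k)⟩).symm
      have hmono : Monotone fun n : ℕ => f '' (T ∩ {x | x k ≤ n}) := fun a b hab =>
        image_mono (inter_subset_inter_right _ fun x (hx : x k ≤ a) => hx.trans hab)
      have hT' := hT
      -- Continuity from below holds for arbitrary increasing sets, so the images need not be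
      -- measurable.
      rw [hU, hmono.measure_iUnion, lt_iSup_iff] at hT'
      exact hT'.imp fun n hn _ => hn
    · exact ⟨0, fun h => absurd h hT⟩
  choose g hg using step
  let T : ℕ → Set (ℕ → ℕ) := fun k => Nat.rec univ (fun k T => T ∩ {x | x k ≤ g k T}) k
  have hT : ∀ k, c < μ (f '' T k) := by
    intro k
    induction k with
    | zero => simpa [T] using hc
    | succ k ih => exact hg k (T k) ih
  let n : ℕ → ℕ := fun k => g k (T k)
  have hTn : ∀ k, T k = {x | ∀ i < k, x i ≤ n i} := by
    intro k
    induction k with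
    | zero => simp [T]
    | succ k ih =>
      change T k ∩ {x | x k ≤ n k} = _
      rw [ih]
      ext x
      simp only [mem_inter_iff, mem_ofPred_eq, Nat.lt_succ_iff_lt_or_eq]
      constructor
      · rintro ⟨h1, h2⟩ i (hi | rfl)
        exacts [h1 i hi, h2]
      · exact fun h => ⟨fun i hi => h i (Or.inl hi), h k (Or.inr rfl)⟩
  let C : Set (ℕ → ℕ) := univ.pi fun i => Iic (n i)
  have hC : IsCompact C := isCompact_univ_pi fun i => (finite_Iic (n i)).isCompact
  refine ⟨f '' C, image_subset_range _ _, hC.image hf, ?_⟩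
  rw [(f '' C).measure_eq_iInf_isOpen]
  refine le_iInf₂ fun U hU => le_iInf fun hUo => ?_
  have hcyl : ∀ y ∈ C, ∃ k, PiNat.cylinder y k ⊆ f ⁻¹' U := by
    intro y hy
    obtain ⟨V, ⟨z, k, rfl⟩, hyV, hV⟩ := (PiNat.isTopologicalBasis_cylinders
      (fun _ : ℕ => ℕ)).exists_subset_of_mem_open (hU (mem_image_of_mem f hy) : y ∈ f ⁻¹' U)
      (hUo.preimage hf)
    exact ⟨k, by rwa [← PiNat.mem_cylinder_iff_eq.1 hyV] at hV⟩
  choose! k hk using hcyl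
  obtain ⟨t, htC, ht⟩ := hC.elim_nhds_subcover (fun y => PiNat.cylinder y (k y)) fun y _ =>
    (PiNat.isOpen_cylinder (fun _ : ℕ => ℕ) y (k y)).mem_nhds (PiNat.self_mem_cylinder _ _)
  have hsub : T (t.sup k) ⊆ f ⁻¹' U := by
    intro x hx
    rw [hTn] at hx
    -- Truncating `x` at `n` lands in `C` and changes no coordinate below `t.sup k`, so `x` shares
    -- the cylinder covering its truncation.
    have hmin : (fun i => min (x i) (n i)) ∈ C := fun i _ => mem_Iic.2 (min_le_right _ _)
    obtain ⟨y, hyt, hy⟩ := mem_iUnion₂.1 (ht hmin)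
    refine hk y (htC y hyt) fun i hi => ?_
    rw [← hy i hi]
    exact (min_eq_left (hx i (hi.trans_le (Finset.le_sup hyt)))).symm
  exact (hT _).le.trans (measure_mono (image_subset_iff.2 hsub))

/-- Analytic sets are universally measurable. -/
theorem _root_.MeasureTheory.AnalyticSet.nullMeasurableSet {X : Type*} [TopologicalSpace X]
    [T2Space X] [MeasurableSpace X] [BorelSpace X] {μ : Measure X} [IsFiniteMeasure μ]
    [μ.OuterRegular] {s : Set X} (hs : AnalyticSet s) : NullMeasurableSet s μ := by
  rw [AnalyticSet] at hs
  obtain rfl | ⟨f, hf, rfl⟩ := hs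
  · exact MeasurableSet.empty.nullMeasurableSet
  rcases eq_or_ne (μ (range f)) 0 with h0 | h0
  · exact NullMeasurableSet.of_null h0
  obtain ⟨c, -, hc, hlim⟩ := exists_seq_strictMono_tendsto' (pos_iff_ne_zero.2 h0)
  choose K hKs hK hcK using fun j => exists_isCompact_le_measure_of_lt hf (hc j).2
  have hL : MeasurableSet (⋃ j, K j) := .iUnion fun j => (hK j).measurableSet
  have hLs : (⋃ j, K j) ⊆ range f := iUnion_subset hKs
  have hle : μ (toMeasurable μ (range f)) ≤ μ (⋃ j, K j) := by
    rw [measure_toMeasurable]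
    exact le_of_tendsto' hlim fun j => (hcK j).trans (measure_mono (subset_iUnion K j))
  have hae : (⋃ j, K j : Set X) =ᵐ[μ] toMeasurable μ (range f) :=
    ae_eq_of_subset_of_measure_ge (hLs.trans (subset_toMeasurable _ _)) hle
      hL.nullMeasurableSet (measure_ne_top _ _)
  refine ⟨⋃ j, K j, hL, ?_⟩
  refine Filter.EventuallyLE.antisymm ?_ hLs.eventuallyLE
  exact (subset_toMeasurable μ (range f)).eventuallyLE.trans hae.symm.le

end Analytic


/-! ### The inequality for families of cylinder sets -/

open Measure

section Measure

variable {I S : Type*} [MeasurableSpace S] {μ : MeasureTheory.Measure S} [IsProbabilityMeasure μ]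

/-- Selecting in each coordinate one of two independent copies yields two independent points. -/
lemma measurePreserving_select (e : I → Bool) :
    MeasurePreserving
      (fun ω : Bool × I → S => ((fun i => ω (e i, i)), (fun i => ω (!e i, i))))
      (infinitePi fun _ => μ) ((infinitePi fun _ => μ).prod (infinitePi fun _ => μ)) := by
  -- An injective relabelling of i.i.d. coordinates: copy `true` becomes the one selected by `e`,
  -- copy `false` the other.
  let f : Bool × I → Bool × I := fun p => (p.1 == e p.2, p.2)
  have hf : Function.Injective f := by
    rintro ⟨b, i⟩ ⟨c, j⟩ h
    simp only [f, Prod.mk.injEq] at h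
    obtain ⟨h1, rfl⟩ := h
    cases b <;> cases c <;> cases h2 : e i <;> simp_all
  have hswap : MeasurePreserving (fun (ω : Bool × I → S) p => ω (f p))
      (infinitePi fun _ => μ) (infinitePi fun _ => μ) :=
    ⟨by fun_prop, map_infinitePi_infinitePi_of_inj (P := fun _ => μ) hf⟩
  have hcurry : MeasurePreserving (MeasurableEquiv.curry Bool I S)
      (infinitePi fun _ => μ) (infinitePi fun _ => infinitePi fun _ => μ) :=
    ⟨by fun_prop, infinitePi_map_curry fun _ _ => μ⟩
  have heval : MeasurePreserving (fun ω : Bool → I → S => (ω true, ω false))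
      (infinitePi fun _ => infinitePi fun _ => μ)
      ((infinitePi fun _ => μ).prod (infinitePi fun _ => μ)) :=
    ⟨by fun_prop, infinitePi_map_eval_prod (P := fun _ => infinitePi fun _ => μ) (by simp)⟩
  convert! heval.comp (hcurry.comp hswap) using 1
  funext ω
  refine Prod.ext (funext fun i => ?_) (funext fun i => ?_) <;> simp [f]

/-- A pointwise comparison of the number of occurring events integrates to a comparison of the
sums of their measures. -/
lemma sum_measure_le_sum_measure {Ω κ : Type*} [MeasurableSpace Ω] [Fintype κ]
    {P : MeasureTheory.Measure Ω} {E F : κ → Set Ω} (hE : ∀ k, NullMeasurableSet (E k) P)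
    (hF : ∀ k, NullMeasurableSet (F k) P)
    (h : ∀ ω, {k | ω ∈ E k}.ncard ≤ {k | ω ∈ F k}.ncard) :
    ∑ k, P (E k) ≤ ∑ k, P (F k) := by
  classical
  have key : ∀ G : κ → Set Ω, (∀ k, NullMeasurableSet (G k) P) →
      ∑ k, P (G k) = ∫⁻ ω, (({k | ω ∈ G k}.ncard : ℕ) : ENNReal) ∂P := by
    intro G hG
    simp_rw [← lintegral_indicator_one₀ (hG _)]
    rw [← lintegral_finsetSum' (f := fun k => (G k).indicator 1) _
      fun k _ => aemeasurable_one.indicator₀ (hG k)]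
    refine lintegral_congr fun ω => ?_
    rw [Set.ncard_eq_toFinset_card', Finset.card_eq_sum_ones, Set.toFinset_ofPred,
      Finset.sum_filter]
    simp [Set.indicator_apply]
  rw [key E hE, key F hF]
  exact lintegral_mono fun ω => Nat.cast_le.2 (h ω)

variable {𝒜 ℬ : Finset I → Set (I → S)}

/-- The BKR inequality for reasons inside a finite set of coordinates. -/
lemma measure_disjoint_occurrence_le_of_finite [Countable I]
    (h𝒜 : ∀ J, 𝒜 J ⊆ maxCyl (𝒜 J) J) (hℬ : ∀ J, ℬ J ⊆ maxCyl (ℬ J) J)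
    (m𝒜 : ∀ J, NullMeasurableSet (𝒜 J) (infinitePi fun _ => μ))
    (mℬ : ∀ J, NullMeasurableSet (ℬ J) (infinitePi fun _ => μ)) (N : Finset I) :
    infinitePi (fun _ => μ) {ω | ∃ J ⊆ N, ∃ K ⊆ N, Disjoint J K ∧ ω ∈ 𝒜 J ∧ ω ∈ ℬ K} ≤
      infinitePi (fun _ => μ) {ω | ∃ J ⊆ N, ω ∈ 𝒜 J} *
        infinitePi (fun _ => μ) {ω | ∃ K ⊆ N, ω ∈ ℬ K} := by
  classical
  set U := {ω | ∃ J ⊆ N, ∃ K ⊆ N, Disjoint J K ∧ ω ∈ 𝒜 J ∧ ω ∈ ℬ K} with hU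
  set A := {ω | ∃ J ⊆ N, ω ∈ 𝒜 J} with hA
  set B := {ω | ∃ K ⊆ N, ω ∈ ℬ K} with hB
  set m' := infinitePi fun _ : I => μ
  have mA : NullMeasurableSet A m' := by
    have : A = ⋃ J, ⋃ _ : J ⊆ N, 𝒜 J := by ext; simp [hA]
    rw [this]
    exact .iUnion fun J => .iUnion fun _ => m𝒜 J
  have mB : NullMeasurableSet B m' := by
    have : B = ⋃ J, ⋃ _ : J ⊆ N, ℬ J := by ext; simp [hB]
    rw [this]
    exact .iUnion fun J => .iUnion fun _ => mℬ J
  have mU : NullMeasurableSet U m' := by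
    have : U = ⋃ J, ⋃ _ : J ⊆ N, ⋃ K, ⋃ _ : K ⊆ N, ⋃ _ : Disjoint J K, 𝒜 J ∩ ℬ K := by
      ext; simp only [hU, Set.mem_ofPred_eq, Set.mem_iUnion, Set.mem_inter_iff, exists_prop]
    rw [this]
    exact .iUnion fun J => .iUnion fun _ => .iUnion fun K => .iUnion fun _ =>
      .iUnion fun _ => (m𝒜 J).inter (mℬ K)
  -- The value `true` off `N` is arbitrary: `A` and `B` depend only on the coordinates in `N`.
  let ext : (N → Bool) → I → Bool := fun ε i => if h : i ∈ N then ε ⟨i, h⟩ else true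
  let sel : (N → Bool) → (Bool × I → S) → (I → S) × (I → S) := fun ε ω =>
    ((fun i => ω (ext ε i, i)), (fun i => ω (!ext ε i, i)))
  have hsel : ∀ ε, MeasurePreserving (sel ε) (infinitePi fun _ => μ) (m'.prod m') := fun ε =>
    measurePreserving_select (ext ε)
  have mU' : NullMeasurableSet (U ×ˢ (Set.univ : Set (I → S))) (m'.prod m') :=
    mU.prod MeasurableSet.univ.nullMeasurableSet
  have mAB : NullMeasurableSet (A ×ˢ B) (m'.prod m') := mA.prod mB
  have hsum := sum_measure_le_sum_measure
    (E := fun ε => sel ε ⁻¹' (U ×ˢ Set.univ)) (F := fun ε => sel ε ⁻¹' (A ×ˢ B))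
    (fun ε => mU'.preimage (hsel ε).quasiMeasurePreserving)
    (fun ε => mAB.preimage (hsel ε).quasiMeasurePreserving) ?_
  · simp only [(hsel _).measure_preimage mU', (hsel _).measure_preimage mAB, prod_prod,
      measure_univ, mul_one, Finset.sum_const, nsmul_eq_mul] at hsum
    exact (ENNReal.mul_le_mul_iff_right (by simp) (by simp)).1 hsum
  · intro ω
    have hX : ∀ ε, ∃ J ⊆ N, (sel ε ω).1 ∈ U →
        ∃ K ⊆ N, Disjoint J K ∧ (sel ε ω).1 ∈ 𝒜 J ∧ (sel ε ω).1 ∈ ℬ K := by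
      intro ε
      by_cases h : (sel ε ω).1 ∈ U
      · obtain ⟨J, hJ, h'⟩ := h
        exact ⟨J, hJ, fun _ => h'⟩
      · exact ⟨∅, by simp, fun h' => absurd h' h⟩
    choose J hJN hJ using hX
    -- The fixed directions for `A` are `J ε`; the witness `K` for `B` is disjoint from it, hence
    -- lies in the complementary directions.
    have hcard := card_le_card_inter_reflection (fun ε i => decide (i.1 ∈ J ε))
      (Finset.univ.filter fun ε => (sel ε ω).1 ∈ A) (Finset.univ.filter fun ε => (sel ε ω).1 ∈ B)
      (Finset.univ.filter fun ε => (sel ε ω).1 ∈ U) ?_ ?_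
    · rw [Set.ncard_eq_toFinset_card', Set.ncard_eq_toFinset_card']
      convert hcard using 2
      · ext ε
        simp
      · ext ε
        simp only [Set.mem_toFinset, Set.mem_ofPred_eq, Finset.mem_filter, Finset.mem_univ,
          true_and, Set.mem_preimage, Set.mem_prod]
        refine and_congr_right fun _ => ?_
        -- Reflecting `ε` exchanges the two selected points on `N`, though not off `N`.
        have hagree : ∀ K ⊆ N, ∀ i ∈ K, (sel (fun i => !ε i) ω).1 i = (sel ε ω).2 i := by
          intro K hK i hi
          simp [sel, ext, hK hi]
        exact ⟨fun ⟨K, hK, h⟩ => ⟨K, hK, hℬ K h fun i hi => hagree K hK i hi⟩,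
          fun ⟨K, hK, h⟩ => ⟨K, hK, hℬ K h fun i hi => (hagree K hK i hi).symm⟩⟩
    · intro ε hε z hz
      obtain ⟨K, hK, hd, h1, h2⟩ := hJ ε (Finset.mem_filter.1 hε).2
      refine Finset.mem_filter.2 ⟨Finset.mem_univ _, J ε, hJN ε, h𝒜 _ h1 fun i hi => ?_⟩
      have := hz ⟨i, hJN ε hi⟩ (by simpa using hi)
      simp [sel, ext, hJN ε hi, this]
    · intro ε hε z hz
      obtain ⟨K, hK, hd, h1, h2⟩ := hJ ε (Finset.mem_filter.1 hε).2
      refine Finset.mem_filter.2 ⟨Finset.mem_univ _, K, hK, hℬ _ h2 fun i hi => ?_⟩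
      have := hz ⟨i, hK hi⟩ (by simpa using Finset.disjoint_right.1 hd hi)
      simp [sel, ext, hK (Finset.mem_coe.1 hi), this]

/-- The BKR inequality for two families of cylinder sets. -/
lemma measure_disjoint_occurrence_le [Countable I]
    (h𝒜 : ∀ J, 𝒜 J ⊆ maxCyl (𝒜 J) J) (hℬ : ∀ J, ℬ J ⊆ maxCyl (ℬ J) J)
    (m𝒜 : ∀ J, NullMeasurableSet (𝒜 J) (infinitePi fun _ => μ))
    (mℬ : ∀ J, NullMeasurableSet (ℬ J) (infinitePi fun _ => μ)) :
    infinitePi (fun _ => μ) {ω | ∃ J K, Disjoint J K ∧ ω ∈ 𝒜 J ∧ ω ∈ ℬ K} ≤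
      infinitePi (fun _ => μ) (⋃ J, 𝒜 J) * infinitePi (fun _ => μ) (⋃ K, ℬ K) := by
  classical
  have hU : {ω | ∃ J K, Disjoint J K ∧ ω ∈ 𝒜 J ∧ ω ∈ ℬ K} =
      ⋃ N : Finset I, {ω | ∃ J ⊆ N, ∃ K ⊆ N, Disjoint J K ∧ ω ∈ 𝒜 J ∧ ω ∈ ℬ K} := by
    ext ω
    simp only [Set.mem_ofPred_eq, Set.mem_iUnion]
    constructor
    · rintro ⟨J, K, h⟩
      exact ⟨J ∪ K, J, Finset.subset_union_left, K, Finset.subset_union_right, h⟩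
    · rintro ⟨N, J, -, K, -, h⟩
      exact ⟨J, K, h⟩
  have hmono : Monotone fun N : Finset I =>
      {ω | ∃ J ⊆ N, ∃ K ⊆ N, Disjoint J K ∧ ω ∈ 𝒜 J ∧ ω ∈ ℬ K} := by
    rintro N N' hN ω ⟨J, hJ, K, hK, h⟩
    exact ⟨J, hJ.trans hN, K, hK.trans hN, h⟩
  rw [hU, hmono.directed_le.measure_iUnion]
  refine iSup_le fun N =>
    (measure_disjoint_occurrence_le_of_finite h𝒜 hℬ m𝒜 mℬ N).trans ?_
  exact mul_le_mul' (measure_mono fun ω ⟨J, _, h⟩ => Set.mem_iUnion.2 ⟨J, h⟩)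
    (measure_mono fun ω ⟨J, _, h⟩ => Set.mem_iUnion.2 ⟨J, h⟩)

/-- The simultaneous BKR inequality for finitely many families of cylinder sets. -/
lemma measure_disjoint_occurrence_fold_le [Countable I] {r : ℕ}
    {𝒜 : Fin r → Finset I → Set (I → S)} (h𝒜 : ∀ i J, 𝒜 i J ⊆ maxCyl (𝒜 i J) J)
    (m𝒜 : ∀ i J, NullMeasurableSet (𝒜 i J) (infinitePi fun _ => μ)) :
    infinitePi (fun _ => μ) {ω | ∃ J : Fin r → Finset I,
        (∀ i j, i ≠ j → Disjoint (J i) (J j)) ∧ ∀ i, ω ∈ 𝒜 i (J i)} ≤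
      ∏ i, infinitePi (fun _ => μ) (⋃ J, 𝒜 i J) := by
  classical
  induction r with
  | zero => simp
  | succ r ih =>
    -- Disjoint occurrence of the last `r` events within `L` is again a measurable cylinder family.
    -- Working with families avoids applying `maxCyl` to a BKR combination, which need not be Borel.
    let 𝒲 : Finset I → Set (I → S) := fun L => {ω | ∃ J : Fin r → Finset I,
      (∀ i j, i ≠ j → Disjoint (J i) (J j)) ∧ (∀ i, J i ⊆ L) ∧ ∀ i, ω ∈ 𝒜 i.succ (J i)}
    have h𝒲 : ∀ L, 𝒲 L ⊆ maxCyl (𝒲 L) L := by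
      rintro L ω ⟨J, hd, hL, hJ⟩ ω' hω'
      exact ⟨J, hd, hL, fun i => h𝒜 _ _ (hJ i) fun j hj => hω' j (hL i hj)⟩
    have m𝒲 : ∀ L, NullMeasurableSet (𝒲 L) (infinitePi fun _ => μ) := by
      intro L
      have : 𝒲 L = ⋃ J : Fin r → Finset I, ⋃ _ : ∀ i j, i ≠ j → Disjoint (J i) (J j),
          ⋃ _ : ∀ i, J i ⊆ L, ⋂ i, 𝒜 i.succ (J i) := by
        ext; simp only [𝒲, Set.mem_ofPred_eq, Set.mem_iUnion, Set.mem_iInter, exists_prop]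
      rw [this]
      exact .iUnion fun J => .iUnion fun _ => .iUnion fun _ => .iInter fun i => m𝒜 _ _
    rw [Fin.prod_univ_succ]
    refine (measure_mono ?_).trans ((measure_disjoint_occurrence_le (h𝒜 0) h𝒲 (m𝒜 0) m𝒲).trans
      (mul_le_mul_right ((measure_mono ?_).trans (ih (fun i => h𝒜 i.succ) fun i => m𝒜 i.succ)) _))
    · rintro ω ⟨J, hd, hJ⟩
      refine ⟨J 0, Finset.univ.biUnion fun i : Fin r => J i.succ, ?_, hJ 0, fun i => J i.succ,
        fun i j hij => hd _ _ (by simpa using hij),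
        fun i => Finset.subset_biUnion_of_mem (fun i : Fin r => J i.succ) (Finset.mem_univ i),
        fun i => hJ _⟩
      exact (Finset.disjoint_biUnion_right _ _ _).2 fun i _ => hd _ _ (Fin.succ_ne_zero i).symm
    · intro ω hω
      obtain ⟨L, J, hd, -, hJ⟩ := Set.mem_iUnion.1 hω
      exact ⟨J, hd, hJ⟩

end Measure

/-! ### Measurability of maximal cylinders and conclusion -/

lemma maxCyl_subset {I S : Type*} (A : Set (I → S)) (K : Set I) : maxCyl A K ⊆ A :=
  fun _ h => h fun _ _ => rfl

lemma maxCyl_subset_maxCyl_maxCyl {I S : Type*} (A : Set (I → S)) (K : Set I) :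
    maxCyl A K ⊆ maxCyl (maxCyl A K) K :=
  fun _ h _ h' _ h'' => h fun i hi => (h'' i hi).trans (h' i hi)

/-- The largest cylinder set contained in a Borel set is coanalytic. -/
lemma nullMeasurableSet_maxCyl {I S : Type*} [Countable I] [TopologicalSpace S] [PolishSpace S]
    [MeasurableSpace S] [BorelSpace S] {P : MeasureTheory.Measure (I → S)} [IsFiniteMeasure P]
    {A : Set (I → S)} (hA : MeasurableSet A) (K : Set I) : NullMeasurableSet (maxCyl A K) P := by
  classical
  let f : (I → S) × (I → S) → I → S := fun p i => if i ∈ K then p.1 i else p.2 i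
  have hf : Continuous f := continuous_pi fun i => by
    by_cases hi : i ∈ K <;> simp only [f, hi, if_true, if_false] <;> fun_prop
  -- A point fails to lie in `[A]_K` exactly when it glues a point of `Aᶜ` on `K` to an arbitrary
  -- point off `K`.
  have h : (maxCyl A K)ᶜ = f '' (Aᶜ ×ˢ Set.univ) := by
    ext ω
    simp only [maxCyl, Cyl, Set.mem_compl_iff, Set.mem_ofPred_eq, Set.not_subset, Set.mem_image,
      Set.mem_prod, Set.mem_univ, and_true, Prod.exists]
    constructor
    · rintro ⟨ω', h1, h2⟩
      refine ⟨ω', ω, h2, funext fun i => ?_⟩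
      by_cases hi : i ∈ K <;> simp [f, hi, h1]
    · rintro ⟨ω', ω'', h1, rfl⟩
      exact ⟨ω', fun i hi => by simp [f, hi], h1⟩
  have hA' : AnalyticSet (Aᶜ ×ˢ (Set.univ : Set (I → S))) :=
    (hA.compl.prod MeasurableSet.univ).analyticSet
  rw [← NullMeasurableSet.compl_iff, h]
  exact (hA'.image_of_continuous hf).nullMeasurableSet

end BKR

theorem mainTheorem4 :
    (∀ A B : Set (ℕ → unitInterval), MeasurableSet A → MeasurableSet B →
      BKR.LebesgueMeasurable (BKR.bkr A B) ∧
        BKR.lam (BKR.bkr A B) ≤ BKR.m A * BKR.m B) ∧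
    (∀ (r : ℕ) (A : Fin r → Set (ℕ → unitInterval)), (∀ i, MeasurableSet (A i)) →
      BKR.LebesgueMeasurable (BKR.bkrFold A) ∧
        BKR.lam (BKR.bkrFold A) ≤ ∏ i, BKR.m (A i)) := by
  have hm : IsProbabilityMeasure BKR.m := by unfold BKR.m; infer_instance
  refine ⟨fun A B hA hB => ⟨?_, ?_⟩, fun r A hA => ⟨?_, ?_⟩⟩
  · have h : BKR.bkr A B = ⋃ J : Finset ℕ, ⋃ K : Finset ℕ, ⋃ _ : Disjoint J K,
        BKR.maxCyl A J ∩ BKR.maxCyl B K := by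
      ext; simp only [BKR.bkr, Set.mem_ofPred_eq, Set.mem_iUnion, Set.mem_inter_iff, exists_prop]
    rw [BKR.LebesgueMeasurable, h]
    exact .iUnion fun J => .iUnion fun K => .iUnion fun _ =>
      (BKR.nullMeasurableSet_maxCyl hA _).inter (BKR.nullMeasurableSet_maxCyl hB _)
  · rw [BKR.lam, Measure.completion_apply]
    exact (BKR.measure_disjoint_occurrence_le
      (𝒜 := fun J => BKR.maxCyl A J) (ℬ := fun J => BKR.maxCyl B J)
      (fun J => BKR.maxCyl_subset_maxCyl_maxCyl A J)
      (fun J => BKR.maxCyl_subset_maxCyl_maxCyl B J)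
      (fun J => BKR.nullMeasurableSet_maxCyl (P := BKR.m) hA J)
      (fun J => BKR.nullMeasurableSet_maxCyl (P := BKR.m) hB J)).trans
      (mul_le_mul' (measure_mono (Set.iUnion_subset fun J => BKR.maxCyl_subset A J))
        (measure_mono (Set.iUnion_subset fun J => BKR.maxCyl_subset B J)))
  · have h : BKR.bkrFold A = ⋃ J : Fin r → Finset ℕ,
        ⋃ _ : ∀ i j, i ≠ j → Disjoint (J i) (J j), ⋂ i, BKR.maxCyl (A i) (J i) := by
      ext; simp [BKR.bkrFold]
    rw [BKR.LebesgueMeasurable, h]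
    exact .iUnion fun J => .iUnion fun _ => .iInter fun i =>
      BKR.nullMeasurableSet_maxCyl (hA i) _
  · have h : BKR.bkrFold A = {ω | ∃ J : Fin r → Finset ℕ,
        (∀ i j, i ≠ j → Disjoint (J i) (J j)) ∧ ∀ i, ω ∈ BKR.maxCyl (A i) (J i)} := by
      ext; simp [BKR.bkrFold]
    rw [BKR.lam, Measure.completion_apply, h]
    exact (BKR.measure_disjoint_occurrence_fold_le
      (𝒜 := fun i J => BKR.maxCyl (A i) J)
      (fun i J => BKR.maxCyl_subset_maxCyl_maxCyl (A i) J)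
      (fun i J => BKR.nullMeasurableSet_maxCyl (P := BKR.m) (hA i) J)).trans
      (Finset.prod_le_prod' fun i _ =>
        measure_mono (Set.iUnion_subset fun J => BKR.maxCyl_subset (A i) J))
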